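/- Let $X$ be a real Banach lattice, let $1<p<\infty$, and let $p^*=p/(p-1)$. The dual $X^*$ carries its natural order ($f\le g$ iff $f(x)\le g(x)$ for all $x\ge 0$ in $X$), for which it is a Banach lattice. Let $\ell_{p^*,|\omega|}(X^*)$ be the space of all sequences $(x_n^*)_n$ in $X^*$ with $\sum_{n}\big(|x_n^*|(x)\big)^{p^*}<\infty$ for every $x\ge 0$ in $X$, with the termwise order and the norm $$\|(x_n^*)_n\|_{p^*,|\omega|}=\sup\Big\{\Big(\sum_{n}\big(|x_n^*|(x)\big)^{p^*}\Big)^{1/p^*} : x\in X,\ x\ge 0,\ \|x\|\le 1\Big\}.$$ Let $\ell_p^{\pi}(X)$ be the space of all sequences $(x_n)_n$ in $X$ such that $\sum_n |x_n^*(|x_n|)|<\infty$ for every positive $(x_n^*)_n\in \ell_{p^*,|\omega|}(X^*)$, with the termwise order and the norm $$\|(x_n)_n\|_{\ell_p^{\pi}(X)}=\sup\Big\{\sum_{n}x_n^*(|x_n|) : (x_n^*)_n\in \ell_{p^*,|\omega|}(X^*),\ (x_n^*)_n\ge 0,\ \|(x_n^*)_n\|_{p^*,|\omega|}\le 1\Big\}.$$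 Both are normed vector lattices. Then for every $(x_n^*)_n\in\ell_{p^*,|\omega|}(X^*)$ and $(x_n)_n\in\ell_p^\pi(X)$ the series $\sum_n x_n^*(x_n)$ converges unconditionally, and $$T\big((x_n^*)_n\big)\big((x_n)_n\big)=\sum_{n}x_n^*(x_n)$$ defines a linear isometry $T$ of $\ell_{p^*,|\omega|}(X^*)$ onto the dual $[\ell_p^{\pi}(X)]^*$ (with the dual norm and the natural order) which preserves the lattice operations: $T(a\vee b)=T(a)\vee T(b)$ and $T(a\wedge b)=T(a)\wedge T(b)$. Thus $\ell_{p^*,|\omega|}(X^*)$ is lattice isometrically isomorphic to $[\ell_p^{\pi}(X)]^*$. -/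

import Mathlib

set_option linter.unusedSectionVars false

noncomputable section

/-! ## The order dual of a normed lattice -/

namespace DualLattice

variable {X : Type*} [NormedAddCommGroup X] [NormedSpace ℝ X] [Lattice X] [HasSolidNorm X]
  [IsOrderedAddMonoid X]

theorem norm_le_of_nonneg_of_le {x y : X} (hx : 0 ≤ x) (hxy : x ≤ y) : ‖x‖ ≤ ‖y‖ := by
  apply HasSolidNorm.solid
  rwa [abs_of_nonneg hx, abs_of_nonneg (hx.trans hxy)]

/-- The natural order on the dual: `f ≤ g` iff `f x ≤ g x` for all `x ≥ 0`. -/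
instance instPartialOrder : PartialOrder (StrongDual ℝ X) where
  le f g := ∀ x : X, 0 ≤ x → f x ≤ g x
  le_refl f x _ := le_rfl
  le_trans f g h h₁ h₂ x hx := (h₁ x hx).trans (h₂ x hx)
  le_antisymm f g h₁ h₂ := by
    have h : ∀ x : X, 0 ≤ x → f x = g x := fun x hx => le_antisymm (h₁ x hx) (h₂ x hx)
    ext x
    rw [← posPart_sub_negPart x, map_sub, map_sub, h _ (posPart_nonneg x),
      h _ (negPart_nonneg x)]

theorem le_def {f g : StrongDual ℝ X} : f ≤ g ↔ ∀ x : X, 0 ≤ x → f x ≤ g x := Iff.rfl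

instance instIsOrderedAddMonoid : IsOrderedAddMonoid (StrongDual ℝ X) where
  add_le_add_left f g h k x hx := by
    simpa using h x hx

/-- The Riesz–Kantorovich formula for the positive part of a functional, on the positive cone. -/
def posFun (f : StrongDual ℝ X) (x : X) : ℝ := sSup (f '' Set.Icc 0 x)

theorem bddAbove_image (f : StrongDual ℝ X) (x : X) : BddAbove (f '' Set.Icc 0 x) := by
  refine ⟨‖f‖ * ‖x‖, ?_⟩
  rintro _ ⟨y, hy, rfl⟩
  refine (le_abs_self _).trans ((f.le_opNorm y).trans ?_)
  exact mul_le_mul_of_nonneg_left (norm_le_of_nonneg_of_le hy.1 hy.2) (norm_nonneg _)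

theorem le_posFun (f : StrongDual ℝ X) {x y : X} (hy : 0 ≤ y) (hyx : y ≤ x) :
    f y ≤ posFun f x := le_csSup (bddAbove_image f x) ⟨y, ⟨hy, hyx⟩, rfl⟩

theorem posFun_le (f : StrongDual ℝ X) {x : X} (hx : 0 ≤ x) {c : ℝ}
    (h : ∀ y, 0 ≤ y → y ≤ x → f y ≤ c) : posFun f x ≤ c := by
  refine csSup_le ⟨_, 0, ⟨le_rfl, hx⟩, rfl⟩ ?_
  rintro _ ⟨y, hy, rfl⟩
  exact h y hy.1 hy.2

theorem posFun_nonneg (f : StrongDual ℝ X) {x : X} (hx : 0 ≤ x) : 0 ≤ posFun f x := by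
  simpa using le_posFun f le_rfl hx

theorem posFun_le_norm (f : StrongDual ℝ X) {x : X} (hx : 0 ≤ x) : posFun f x ≤ ‖f‖ * ‖x‖ := by
  refine posFun_le f hx fun y hy hyx => (le_abs_self _).trans ((f.le_opNorm y).trans ?_)
  exact mul_le_mul_of_nonneg_left (norm_le_of_nonneg_of_le hy hyx) (norm_nonneg _)

theorem posFun_add (f : StrongDual ℝ X) {x y : X} (hx : 0 ≤ x) (hy : 0 ≤ y) :
    posFun f (x + y) = posFun f x + posFun f y := by
  apply le_antisymm
  · refine posFun_le f (add_nonneg hx hy) fun z hz hzxy => ?_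
    have h1 : f (z ⊓ x) ≤ posFun f x := le_posFun f (le_inf hz hx) inf_le_right
    have h2 : f (z - z ⊓ x) ≤ posFun f y := by
      refine le_posFun f (sub_nonneg.2 inf_le_left) ?_
      rw [sub_le_iff_le_add, add_inf]
      refine le_inf (le_add_of_nonneg_left hy) ?_
      rwa [add_comm]
    rw [map_sub] at h2
    linarith
  · rw [← le_sub_iff_add_le]
    refine posFun_le f hx fun u hu hux => ?_
    rw [le_sub_comm]
    refine posFun_le f hy fun v hv hvy => ?_
    have := le_posFun f (add_nonneg hu hv) (add_le_add hux hvy)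
    rw [map_add] at this
    linarith

/-- The positive part of a functional, as an additive map on the whole space. -/
def posHom (f : StrongDual ℝ X) : X →+ ℝ where
  toFun x := posFun f x⁺ - posFun f x⁻
  map_zero' := by simp
  map_add' x y := by
    have h : (x + y)⁺ + (x⁻ + y⁻) = (x + y)⁻ + (x⁺ + y⁺) := by
      have h1 := posPart_sub_negPart (x + y)
      have h2 := posPart_sub_negPart x
      have h3 := posPart_sub_negPart y
      rw [sub_eq_iff_eq_add] at h1
      rw [h1]
      nth_rw 1 [← h2]
      nth_rw 1 [← h3]
      abel
    have h' := congrArg (posFun f) h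
    rw [posFun_add f (posPart_nonneg _) (add_nonneg (negPart_nonneg _) (negPart_nonneg _)),
      posFun_add f (negPart_nonneg _) (add_nonneg (posPart_nonneg _) (posPart_nonneg _)),
      posFun_add f (negPart_nonneg _) (negPart_nonneg _),
      posFun_add f (posPart_nonneg _) (posPart_nonneg _)] at h'
    linarith

theorem posHom_bound (f : StrongDual ℝ X) (x : X) : ‖posHom f x‖ ≤ ‖f‖ * ‖x‖ := by
  have hp : ‖x⁺‖ ≤ ‖x‖ := by
    refine HasSolidNorm.solid ?_
    rw [abs_of_nonneg (posPart_nonneg x), ← posPart_add_negPart x]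
    exact le_add_of_nonneg_right (negPart_nonneg x)
  have hn : ‖x⁻‖ ≤ ‖x‖ := by
    refine HasSolidNorm.solid ?_
    rw [abs_of_nonneg (negPart_nonneg x), ← posPart_add_negPart x]
    exact le_add_of_nonneg_left (posPart_nonneg x)
  have h1 := posFun_nonneg f (posPart_nonneg x)
  have h2 := posFun_nonneg f (negPart_nonneg x)
  have h3 := (posFun_le_norm f (posPart_nonneg x)).trans
    (mul_le_mul_of_nonneg_left hp (norm_nonneg f))
  have h4 := (posFun_le_norm f (negPart_nonneg x)).trans
    (mul_le_mul_of_nonneg_left hn (norm_nonneg f))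
  change |posFun f x⁺ - posFun f x⁻| ≤ _
  rw [abs_le]
  constructor <;> linarith

/-- The positive part of a functional, as a functional. -/
def pos (f : StrongDual ℝ X) : StrongDual ℝ X :=
  (posHom f).toRealLinearMap
    (AddMonoidHomClass.continuous_of_bound (posHom f) ‖f‖ (posHom_bound f))

theorem pos_apply (f : StrongDual ℝ X) {x : X} (hx : 0 ≤ x) : pos f x = posFun f x := by
  change posFun f x⁺ - posFun f x⁻ = _
  rw [posPart_of_nonneg hx, negPart_of_nonneg hx]
  have : posFun f (0 : X) = 0 := by simp [posFun]
  rw [this, sub_zero]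

/-- The dual of a normed lattice is a lattice: `f ⊔ g = f + (g - f)⁺`, where the positive part is
given by the Riesz–Kantorovich formula. -/
instance instLattice : Lattice (StrongDual ℝ X) where
  __ := instPartialOrder
  sup f g := f + pos (g - f)
  inf f g := f - pos (f - g)
  le_sup_left f g x hx := by
    simpa [pos_apply _ hx] using posFun_nonneg (g - f) hx
  le_sup_right f g x hx := by
    have := le_posFun (g - f) hx le_rfl
    simp only [add_apply, sub_apply, pos_apply _ hx] at this ⊢
    linarith
  sup_le f g h hf hg x hx := by
    have : posFun (g - f) x ≤ h x - f x := by
      refine posFun_le _ hx fun y hy hyx => ?_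
      have h1 := hg y hy
      have h2 := hf (x - y) (sub_nonneg.2 hyx)
      simp only [map_sub, sub_apply] at h2 ⊢
      linarith
    simp only [add_apply, pos_apply _ hx]
    linarith
  inf_le_left f g x hx := by
    simpa [pos_apply _ hx] using posFun_nonneg (f - g) hx
  inf_le_right f g x hx := by
    have := le_posFun (f - g) hx le_rfl
    simp only [sub_apply, pos_apply _ hx] at this ⊢
    linarith
  le_inf h f g hf hg x hx := by
    have : posFun (f - g) x ≤ f x - h x := by
      refine posFun_le _ hx fun y hy hyx => ?_
      have h1 := hg y hy
      have h2 := hf (x - y) (sub_nonneg.2 hyx)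
      simp only [map_sub, sub_apply] at h2 ⊢
      linarith
    simp only [sub_apply, pos_apply _ hx]
    linarith

theorem apply_nonneg {f : StrongDual ℝ X} (hf : 0 ≤ f) {x : X} (hx : 0 ≤ x) : 0 ≤ f x := by
  simpa using hf x hx

theorem abs_apply_nonneg (f : StrongDual ℝ X) {x : X} (hx : 0 ≤ x) : 0 ≤ |f| x :=
  apply_nonneg (abs_nonneg f) hx

theorem apply_mono {f : StrongDual ℝ X} (hf : 0 ≤ f) {x y : X} (h : x ≤ y) : f x ≤ f y := by
  have := apply_nonneg hf (sub_nonneg.2 h)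
  rw [map_sub] at this
  linarith

theorem abs_smul_le (c : ℝ) (f : StrongDual ℝ X) : |c • f| ≤ |c| • |f| := by
  rw [abs_le']
  constructor <;> intro x hx <;>
  · have h1 := le_abs_self f x hx
    have h2 := neg_le_abs f x hx
    have h3 := abs_apply_nonneg f hx
    have h4 : |f x| ≤ |f| x := abs_le.2 ⟨by simp at h2; linarith, h1⟩
    have h5 : |c * f x| ≤ |c| * |f| x := by
      rw [abs_mul]; exact mul_le_mul_of_nonneg_left h4 (abs_nonneg c)
    have := abs_le.1 h5
    simp
    linarith

/-- `|f y| ≤ f |y|` for a positive functional `f`. -/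
theorem abs_apply_le {f : StrongDual ℝ X} (hf : 0 ≤ f) (y : X) : |f y| ≤ f |y| := by
  rw [abs_le']
  refine ⟨apply_mono hf (le_abs_self y), ?_⟩
  rw [← map_neg]
  exact apply_mono hf (neg_le_abs y)

end DualLattice

/-! ## Positive weakly `q`-summable sequences in the dual -/

open DualLattice

section Weak

variable (q : ℝ) [hq : Fact (1 ≤ q)] (X : Type*) [NormedAddCommGroup X] [NormedSpace ℝ X]
  [Lattice X] [HasSolidNorm X] [IsOrderedAddMonoid X]

/-- The vector space of all sequences `(aₙ)` in the dual of `X` such that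
`∑ₙ |aₙ|(x) ^ q < ∞` for all `x ≥ 0` in `X`. -/
def posWeakDualSubmodule : Submodule ℝ (ℕ → StrongDual ℝ X) where
  carrier := {a | ∀ x : X, 0 ≤ x → Summable fun n => (|a n| x) ^ q}
  zero_mem' x _ := by
    have : q ≠ 0 := (zero_lt_one.trans_le hq.out).ne'
    simp [Real.zero_rpow this]
  add_mem' {a b} ha hb x hx := by
    have h0 : 0 ≤ q := zero_le_one.trans hq.out
    refine Summable.of_nonneg_of_le (fun n => Real.rpow_nonneg (abs_apply_nonneg _ hx) q)
      (fun n => ?_) (Real.summable_Lp_add_of_nonneg hq.out (fun n => abs_apply_nonneg (a n) hx)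
        (fun n => abs_apply_nonneg (b n) hx) (ha x hx) (hb x hx))
    exact Real.rpow_le_rpow (abs_apply_nonneg _ hx) (abs_add_le (a n) (b n) x hx) h0
  smul_mem' c a ha x hx := by
    have h0 : 0 ≤ q := zero_le_one.trans hq.out
    refine Summable.of_nonneg_of_le (fun n => Real.rpow_nonneg (abs_apply_nonneg _ hx) q)
      (fun n => ?_) ((ha x hx).mul_left (|c| ^ q))
    rw [← Real.mul_rpow (abs_nonneg c) (abs_apply_nonneg _ hx)]
    exact Real.rpow_le_rpow (abs_apply_nonneg _ hx) (abs_smul_le c (a n) x hx) h0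

variable {q X}

theorem mem_posWeakDual_of_abs_le {a b : ℕ → StrongDual ℝ X} (hb : b ∈ posWeakDualSubmodule q X)
    (h : ∀ n, |a n| ≤ |b n|) : a ∈ posWeakDualSubmodule q X := fun x hx =>
  Summable.of_nonneg_of_le (fun _ => Real.rpow_nonneg (abs_apply_nonneg _ hx) q)
    (fun n => Real.rpow_le_rpow (abs_apply_nonneg _ hx) (h n x hx) (zero_le_one.trans hq.out))
    (hb x hx)

theorem abs_mem_posWeakDual {a : ℕ → StrongDual ℝ X} (ha : a ∈ posWeakDualSubmodule q X) :
    |a| ∈ posWeakDualSubmodule q X :=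
  mem_posWeakDual_of_abs_le ha fun n => by rw [Pi.abs_apply, abs_abs]

/-- An elementary bound for lattice operations in a lattice ordered group. -/
theorem abs_sup_le_add {G : Type*} [AddCommGroup G] [Lattice G] [IsOrderedAddMonoid G] (a b : G) :
    |a ⊔ b| ≤ |(|a| + |b|)| := by
  rw [abs_of_nonneg (add_nonneg (abs_nonneg a) (abs_nonneg b)), abs_le']
  constructor
  · exact sup_le ((le_abs_self a).trans (le_add_of_nonneg_right (abs_nonneg b)))
      ((le_abs_self b).trans (le_add_of_nonneg_left (abs_nonneg a)))
  · rw [neg_sup]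
    exact inf_le_left.trans ((neg_le_abs a).trans (le_add_of_nonneg_right (abs_nonneg b)))

theorem abs_inf_le_add {G : Type*} [AddCommGroup G] [Lattice G] [IsOrderedAddMonoid G] (a b : G) :
    |a ⊓ b| ≤ |(|a| + |b|)| := by
  have := abs_sup_le_add (-a) (-b)
  rwa [← neg_inf, abs_neg, abs_neg, abs_neg] at this

variable (q X)

/-- `ℓ_{q,|ω|}(X*)`: the space of positive weakly `q`-summable sequences in the dual of `X`. -/
def PosWeakDualSeq : Type _ := posWeakDualSubmodule q X

variable {q X}

namespace PosWeakDualSeq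

instance : AddCommGroup (PosWeakDualSeq q X) := inferInstanceAs
  (AddCommGroup (posWeakDualSubmodule q X))

instance : Module ℝ (PosWeakDualSeq q X) := inferInstanceAs
  (Module ℝ (posWeakDualSubmodule q X))

instance : CoeFun (PosWeakDualSeq q X) (fun _ => ℕ → StrongDual ℝ X) := ⟨fun a => a.1⟩

/-- The order and the lattice operations are the termwise ones. -/
instance : Lattice (PosWeakDualSeq q X) :=
  Subtype.lattice
    (fun {a b} ha hb => mem_posWeakDual_of_abs_le
      (add_mem (abs_mem_posWeakDual ha) (abs_mem_posWeakDual hb))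
      fun n => abs_sup_le_add (a n) (b n))
    (fun {a b} ha hb => mem_posWeakDual_of_abs_le
      (add_mem (abs_mem_posWeakDual ha) (abs_mem_posWeakDual hb))
      fun n => abs_inf_le_add (a n) (b n))

theorem le_def {a b : PosWeakDualSeq q X} : a ≤ b ↔ ∀ n, a n ≤ b n := Iff.rfl

theorem sup_apply (a b : PosWeakDualSeq q X) (n : ℕ) : (a ⊔ b) n = a n ⊔ b n := rfl

theorem inf_apply (a b : PosWeakDualSeq q X) (n : ℕ) : (a ⊓ b) n = a n ⊓ b n := rfl

theorem add_apply (a b : PosWeakDualSeq q X) (n : ℕ) : (a + b) n = a n + b n := rfl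

theorem neg_apply (a : PosWeakDualSeq q X) (n : ℕ) : (-a) n = -a n := rfl

theorem smul_apply (c : ℝ) (a : PosWeakDualSeq q X) (n : ℕ) : (c • a) n = c • a n := rfl

theorem zero_apply (n : ℕ) : (0 : PosWeakDualSeq q X) n = 0 := rfl

theorem ext {a b : PosWeakDualSeq q X} (h : ∀ n, a n = b n) : a = b := Subtype.ext (funext h)

theorem nonneg_apply {a : PosWeakDualSeq q X} (ha : 0 ≤ a) (n : ℕ) : 0 ≤ a n := ha n

instance : IsOrderedAddMonoid (PosWeakDualSeq q X) where
  add_le_add_left _ _ h c n := add_le_add_left (h n) (c n)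

/-- The `ℓ_q`-norm of `(|aₙ|(x))ₙ`. -/
def eval (a : PosWeakDualSeq q X) (x : X) : ℝ := (∑' n, (|a n| x) ^ q) ^ (1 / q)

/-- The norm `sup {(∑ₙ |aₙ|(x) ^ q) ^ (1/q) : x ≥ 0, ‖x‖ ≤ 1}`. -/
instance : Norm (PosWeakDualSeq q X) where
  norm a := ⨆ x : {x : X // 0 ≤ x ∧ ‖x‖ ≤ 1}, eval a x

theorem norm_def (a : PosWeakDualSeq q X) :
    ‖a‖ = ⨆ x : {x : X // 0 ≤ x ∧ ‖x‖ ≤ 1}, (∑' n, (|a n| x) ^ q) ^ (1 / q) := rfl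

theorem summable (a : PosWeakDualSeq q X) {x : X} (hx : 0 ≤ x) :
    Summable fun n => (|a n| x) ^ q := a.2 x hx

theorem tsum_nonneg (a : PosWeakDualSeq q X) {x : X} (hx : 0 ≤ x) :
    0 ≤ ∑' n, (|a n| x) ^ q :=
  _root_.tsum_nonneg fun n => Real.rpow_nonneg (abs_apply_nonneg _ hx) q

theorem eval_nonneg (a : PosWeakDualSeq q X) {x : X} (hx : 0 ≤ x) : 0 ≤ eval a x :=
  Real.rpow_nonneg (tsum_nonneg a hx) _

theorem eval_mono (a : PosWeakDualSeq q X) {x y : X} (hx : 0 ≤ x) (hxy : x ≤ y) :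
    eval a x ≤ eval a y := by
  have h0 : 0 ≤ q := zero_le_one.trans hq.out
  refine Real.rpow_le_rpow (tsum_nonneg a hx) ?_ (by positivity)
  refine (summable a hx).tsum_le_tsum (fun n => ?_) (summable a (hx.trans hxy))
  exact Real.rpow_le_rpow (abs_apply_nonneg _ hx) (apply_mono (abs_nonneg _) hxy) h0

theorem eval_mul {f g : ℕ → ℝ} {c : ℝ} (hc : 0 ≤ c) (hg : ∀ n, 0 ≤ g n)
    (hfg : ∀ n, f n = c * g n) :
    (∑' n, f n ^ q) ^ (1 / q) = c * (∑' n, g n ^ q) ^ (1 / q) := by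
  have h0 : q ≠ 0 := (zero_lt_one.trans_le hq.out).ne'
  have h1 : ∀ n, f n ^ q = c ^ q * g n ^ q := fun n => by
    rw [hfg, Real.mul_rpow hc (hg n)]
  simp_rw [h1]
  rw [tsum_mul_left, Real.mul_rpow (Real.rpow_nonneg hc _)
    (_root_.tsum_nonneg fun n => Real.rpow_nonneg (hg n) q), ← Real.rpow_mul hc,
    mul_one_div_cancel h0, Real.rpow_one]

theorem eval_smul_right (a : PosWeakDualSeq q X) {c : ℝ} (hc : 0 ≤ c) {x : X} (hx : 0 ≤ x) :
    eval a (c • x) = c * eval a x :=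
  eval_mul hc (fun n => abs_apply_nonneg _ hx) fun _ => by simp

theorem eval_le_of_abs_le {a b : PosWeakDualSeq q X} {x : X} (hx : 0 ≤ x)
    (h : ∀ n, |a n| x ≤ |b n| x) : eval a x ≤ eval b x := by
  have h0 : 0 ≤ q := zero_le_one.trans hq.out
  refine Real.rpow_le_rpow (tsum_nonneg a hx) ?_ (by positivity)
  exact (summable a hx).tsum_le_tsum
    (fun n => Real.rpow_le_rpow (abs_apply_nonneg _ hx) (h n) h0) (summable b hx)

theorem eval_add_le (a b : PosWeakDualSeq q X) {x : X} (hx : 0 ≤ x) :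
    eval (a + b) x ≤ eval a x + eval b x := by
  have h0 : 0 ≤ q := zero_le_one.trans hq.out
  have h := Real.Lp_add_le_tsum_of_nonneg hq.out (fun n => abs_apply_nonneg (a n) hx)
    (fun n => abs_apply_nonneg (b n) hx) (summable a hx) (summable b hx)
  refine le_trans (Real.rpow_le_rpow (tsum_nonneg _ hx) ?_ (by positivity)) h.2
  refine (summable (a + b) hx).tsum_le_tsum (fun n => ?_) h.1
  exact Real.rpow_le_rpow (abs_apply_nonneg _ hx) (abs_add_le (a n) (b n) x hx) h0

theorem eval_zero_right (a : PosWeakDualSeq q X) : eval a 0 = 0 := by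
  have := eval_smul_right a le_rfl (le_refl (0 : X))
  simpa using this

variable [IsOrderedModule ℝ X] [CompleteSpace X]

/-- The supremum defining the norm is finite. -/
theorem bddAbove_eval (a : PosWeakDualSeq q X) :
    BddAbove (Set.range fun x : {x : X // 0 ≤ x ∧ ‖x‖ ≤ 1} => eval a x) := by
  by_contra hcon
  have hex : ∀ k : ℕ, ∃ x : X, (0 ≤ x ∧ ‖x‖ ≤ 1) ∧ (4 : ℝ) ^ k < eval a x := by
    intro k
    by_contra! h
    exact hcon ⟨4 ^ k, by rintro _ ⟨x, rfl⟩; exact h x.1 x.2⟩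
  choose x hx hlt using hex
  have hs : Summable fun k : ℕ => ((1 / 2 : ℝ) ^ k) • x k := by
    refine Summable.of_norm_bounded summable_geometric_two fun k => ?_
    rw [norm_smul, Real.norm_of_nonneg (by positivity)]
    exact mul_le_of_le_one_right (by positivity) (hx k).2
  have hnn : ∀ k, 0 ≤ ((1 / 2 : ℝ) ^ k) • x k := fun k => smul_nonneg (by positivity) (hx k).1
  have hle : ∀ k, ((1 / 2 : ℝ) ^ k) • x k ≤ ∑' k, ((1 / 2 : ℝ) ^ k) • x k := fun k =>
    hs.le_tsum k fun j _ => hnn j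
  have hb : ∀ k : ℕ, (2 : ℝ) ^ k ≤ eval a (∑' k, ((1 / 2 : ℝ) ^ k) • x k) := fun k => by
    refine le_trans ?_ (eval_mono a (hnn k) (hle k))
    rw [eval_smul_right a (by positivity) (hx k).1]
    calc (2 : ℝ) ^ k = (1 / 2) ^ k * 4 ^ k := by rw [← mul_pow]; norm_num
      _ ≤ _ := mul_le_mul_of_nonneg_left (hlt k).le (by positivity)
  obtain ⟨k, hk⟩ := pow_unbounded_of_one_lt (eval a (∑' k, ((1 / 2 : ℝ) ^ k) • x k)) one_lt_two
  exact absurd (hb k) (not_le.2 hk)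

theorem eval_le_norm_of_le_one (a : PosWeakDualSeq q X) {x : X} (hx : 0 ≤ x) (h1 : ‖x‖ ≤ 1) :
    eval a x ≤ ‖a‖ := le_ciSup (bddAbove_eval a) ⟨x, hx, h1⟩

theorem norm_le_iff (a : PosWeakDualSeq q X) {c : ℝ} :
    ‖a‖ ≤ c ↔ ∀ x : X, 0 ≤ x → ‖x‖ ≤ 1 → eval a x ≤ c := by
  have : Nonempty {x : X // 0 ≤ x ∧ ‖x‖ ≤ 1} := ⟨⟨0, le_rfl, by simp⟩⟩
  exact ⟨fun h x hx h1 => (eval_le_norm_of_le_one a hx h1).trans h,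
    fun h => ciSup_le fun x => h x.1 x.2.1 x.2.2⟩

theorem norm_nonneg' (a : PosWeakDualSeq q X) : 0 ≤ ‖a‖ :=
  (eval_nonneg a le_rfl).trans (eval_le_norm_of_le_one a le_rfl (by simp))

theorem eval_le_norm (a : PosWeakDualSeq q X) {x : X} (hx : 0 ≤ x) : eval a x ≤ ‖a‖ * ‖x‖ := by
  by_cases h : ‖x‖ = 0
  · rw [norm_eq_zero] at h
    simp [h, eval_zero_right]
  · have hpos : 0 < ‖x‖ := lt_of_le_of_ne (norm_nonneg x) (Ne.symm h)
    have h1 := eval_le_norm_of_le_one a (x := ‖x‖⁻¹ • x) (smul_nonneg (by positivity) hx)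
      (by rw [norm_smul, norm_inv, norm_norm, inv_mul_cancel₀ h])
    rw [eval_smul_right a (by positivity) hx, inv_mul_le_iff₀ hpos] at h1
    linarith

theorem abs_apply_le_eval (a : PosWeakDualSeq q X) {x : X} (hx : 0 ≤ x) (n : ℕ) :
    |a n| x ≤ eval a x := by
  have h0 : 0 < q := zero_lt_one.trans_le hq.out
  rw [eval, ← Real.rpow_le_rpow_iff (abs_apply_nonneg _ hx) (Real.rpow_nonneg (tsum_nonneg a hx) _)
    h0, ← Real.rpow_mul (tsum_nonneg a hx), one_div_mul_cancel h0.ne', Real.rpow_one]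
  exact (summable a hx).le_tsum n fun j _ => Real.rpow_nonneg (abs_apply_nonneg _ hx) q

instance : NormedAddCommGroup (PosWeakDualSeq q X) :=
  AddGroupNorm.toNormedAddCommGroup
    { toFun := norm
      map_zero' := le_antisymm
        ((norm_le_iff _).2 fun x hx _ => by
          have h0 : q ≠ 0 := (zero_lt_one.trans_le hq.out).ne'
          simp [eval, zero_apply, Real.zero_rpow h0, Real.zero_rpow (inv_ne_zero h0)])
        (norm_nonneg' _)
      add_le' := fun a b => (norm_le_iff _).2 fun x hx h1 =>
        (eval_add_le a b hx).trans (add_le_add (eval_le_norm_of_le_one a hx h1)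
          (eval_le_norm_of_le_one b hx h1))
      neg' := fun a => by simp only [norm_def, neg_apply, abs_neg]
      eq_zero_of_map_eq_zero' := fun a (ha : ‖a‖ = 0) => by
        refine ext fun n => ?_
        have h : |a n| ≤ 0 := fun x hx => by
          have h1 := (abs_apply_le_eval a hx n).trans (eval_le_norm a hx)
          simpa [ha] using h1
        rw [zero_apply]
        exact le_antisymm ((le_abs_self _).trans h) (neg_nonpos.1 ((neg_le_abs _).trans h)) }

instance : NormedSpace ℝ (PosWeakDualSeq q X) where
  norm_smul_le c a := (norm_le_iff _).2 fun x hx h1 => by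
    have h2 : eval (c • a) x ≤ eval a (|c| • x) := by
      have h0 : 0 ≤ q := zero_le_one.trans hq.out
      have hcx : 0 ≤ |c| • x := smul_nonneg (abs_nonneg c) hx
      refine Real.rpow_le_rpow (tsum_nonneg _ hx) ?_ (by positivity)
      refine (summable (c • a) hx).tsum_le_tsum (fun n => ?_) (summable a hcx)
      refine Real.rpow_le_rpow (abs_apply_nonneg _ hx) ?_ h0
      have := abs_smul_le c (a n) x hx
      simpa [smul_apply] using this
    rw [eval_smul_right a (abs_nonneg c) hx] at h2
    exact h2.trans (mul_le_mul_of_nonneg_left (eval_le_norm_of_le_one a hx h1) (abs_nonneg c))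

instance : HasSolidNorm (PosWeakDualSeq q X) where
  solid a b h := (norm_le_iff _).2 fun x hx h1 =>
    (eval_le_of_abs_le hx fun n => h n x hx).trans (eval_le_norm_of_le_one b hx h1)

end PosWeakDualSeq

end Weak

/-! ## Positive strongly `p`-summable sequences -/

section Strong

instance factConjExponent {p : ℝ} [hp : Fact (1 < p)] : Fact (1 ≤ p.conjExponent) :=
  ⟨(Real.HolderConjugate.conjExponent hp.out).symm.lt.le⟩

variable (p : ℝ) [hp : Fact (1 < p)] (X : Type*) [NormedAddCommGroup X] [NormedSpace ℝ X]
  [Lattice X] [HasSolidNorm X] [IsOrderedAddMonoid X] [IsOrderedModule ℝ X]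

theorem abs_smul_le_abs_smul_abs {X : Type*} [AddCommGroup X] [Module ℝ X] [Lattice X]
    [IsOrderedAddMonoid X] [IsOrderedModule ℝ X] (c : ℝ) (x : X) : |c • x| ≤ |c| • |x| := by
  rw [abs_le']
  rcases le_total 0 c with hc | hc
  · rw [abs_of_nonneg hc, ← smul_neg]
    exact ⟨smul_le_smul_of_nonneg_left (le_abs_self x) hc,
      smul_le_smul_of_nonneg_left (neg_le_abs x) hc⟩
  · rw [abs_of_nonpos hc, ← neg_smul, ← neg_smul_neg c x]
    exact ⟨smul_le_smul_of_nonneg_left (neg_le_abs x) (neg_nonneg.2 hc),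
      smul_le_smul_of_nonneg_left (le_abs_self x) (neg_nonneg.2 hc)⟩

/-- The vector space of all sequences `(xₙ)` in `X` such that `∑ₙ |bₙ(|xₙ|)| < ∞` for all positive
`(bₙ)` in `ℓ_{p*,|ω|}(X*)`, where `p* = p / (p - 1)`. -/
def posStrongSubmodule : Submodule ℝ (ℕ → X) where
  carrier := {x | ∀ b : PosWeakDualSeq p.conjExponent X, 0 ≤ b → Summable fun n => |b n (|x n|)|}
  zero_mem' b _ := by simp
  add_mem' {x y} hx hy b hb := by
    refine Summable.of_nonneg_of_le (fun n => abs_nonneg _) (fun n => ?_) ((hx b hb).add (hy b hb))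
    have hbn := PosWeakDualSeq.nonneg_apply hb n
    rw [abs_of_nonneg (apply_nonneg hbn (abs_nonneg _)),
      abs_of_nonneg (apply_nonneg hbn (abs_nonneg _)),
      abs_of_nonneg (apply_nonneg hbn (abs_nonneg _)), ← map_add]
    exact apply_mono hbn (abs_add_le (x n) (y n))
  smul_mem' c x hx b hb := by
    refine Summable.of_nonneg_of_le (fun n => abs_nonneg _) (fun n => ?_) ((hx b hb).mul_left |c|)
    have hbn := PosWeakDualSeq.nonneg_apply hb n
    rw [abs_of_nonneg (apply_nonneg hbn (abs_nonneg _)),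
      abs_of_nonneg (apply_nonneg hbn (abs_nonneg _)), ← smul_eq_mul, ← map_smul]
    exact apply_mono hbn (abs_smul_le_abs_smul_abs c (x n))

variable {p X}

theorem mem_posStrong_of_abs_le {x y : ℕ → X} (hy : y ∈ posStrongSubmodule p X)
    (h : ∀ n, |x n| ≤ |y n|) : x ∈ posStrongSubmodule p X := fun b hb => by
  refine Summable.of_nonneg_of_le (fun n => abs_nonneg _) (fun n => ?_) (hy b hb)
  have hbn := PosWeakDualSeq.nonneg_apply hb n
  rw [abs_of_nonneg (apply_nonneg hbn (abs_nonneg _)),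
    abs_of_nonneg (apply_nonneg hbn (abs_nonneg _))]
  exact apply_mono hbn (h n)

theorem abs_mem_posStrong {x : ℕ → X} (hx : x ∈ posStrongSubmodule p X) :
    |x| ∈ posStrongSubmodule p X :=
  mem_posStrong_of_abs_le hx fun n => by rw [Pi.abs_apply, abs_abs]

variable (p X)

/-- `ℓ_p^π(X)`: the space of positive strongly `p`-summable sequences in `X`. -/
def PosStrongSeq : Type _ := posStrongSubmodule p X

variable {p X}

namespace PosStrongSeq

instance : AddCommGroup (PosStrongSeq p X) := inferInstanceAs
  (AddCommGroup (posStrongSubmodule p X))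

instance : Module ℝ (PosStrongSeq p X) := inferInstanceAs
  (Module ℝ (posStrongSubmodule p X))

instance : CoeFun (PosStrongSeq p X) (fun _ => ℕ → X) := ⟨fun x => x.1⟩

/-- The order and the lattice operations are the termwise ones. -/
instance : Lattice (PosStrongSeq p X) :=
  Subtype.lattice
    (fun {x y} hx hy => mem_posStrong_of_abs_le
      (add_mem (abs_mem_posStrong hx) (abs_mem_posStrong hy))
      fun n => abs_sup_le_add (x n) (y n))
    (fun {x y} hx hy => mem_posStrong_of_abs_le
      (add_mem (abs_mem_posStrong hx) (abs_mem_posStrong hy))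
      fun n => abs_inf_le_add (x n) (y n))

theorem le_def {x y : PosStrongSeq p X} : x ≤ y ↔ ∀ n, x n ≤ y n := Iff.rfl

theorem add_apply (x y : PosStrongSeq p X) (n : ℕ) : (x + y) n = x n + y n := rfl

theorem neg_apply (x : PosStrongSeq p X) (n : ℕ) : (-x) n = -x n := rfl

theorem smul_apply (c : ℝ) (x : PosStrongSeq p X) (n : ℕ) : (c • x) n = c • x n := rfl

theorem zero_apply (n : ℕ) : (0 : PosStrongSeq p X) n = 0 := rfl

theorem ext {x y : PosStrongSeq p X} (h : ∀ n, x n = y n) : x = y := Subtype.ext (funext h)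

instance : IsOrderedAddMonoid (PosStrongSeq p X) where
  add_le_add_left _ _ h z n := add_le_add_left (h n) (z n)

instance : IsOrderedModule ℝ (PosStrongSeq p X) where
  smul_le_smul_of_nonneg_left _ hc _ _ h n := smul_le_smul_of_nonneg_left (h n) hc
  smul_le_smul_of_nonneg_right x hx _ _ h n := smul_le_smul_of_nonneg_right h (hx n)

/-- The norm `sup {∑ₙ bₙ(|xₙ|) : b ≥ 0 in ℓ_{p*,|ω|}(X*), ‖b‖ ≤ 1}`. -/
instance : Norm (PosStrongSeq p X) where
  norm x := ⨆ b : {b : PosWeakDualSeq p.conjExponent X // 0 ≤ b ∧ ‖b‖ ≤ 1}, ∑' n, b.1 n |x n|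

theorem norm_def (x : PosStrongSeq p X) :
    ‖x‖ = ⨆ b : {b : PosWeakDualSeq p.conjExponent X // 0 ≤ b ∧ ‖b‖ ≤ 1}, ∑' n, b.1 n |x n| :=
  rfl

theorem summable (x : PosStrongSeq p X) {b : PosWeakDualSeq p.conjExponent X} (hb : 0 ≤ b) :
    Summable fun n => b n |x n| := (x.2 b hb).of_abs

theorem term_nonneg (x : PosStrongSeq p X) {b : PosWeakDualSeq p.conjExponent X} (hb : 0 ≤ b)
    (n : ℕ) : 0 ≤ b n |x n| :=
  apply_nonneg (PosWeakDualSeq.nonneg_apply hb n) (abs_nonneg _)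

variable [CompleteSpace X]

/-- The supremum defining the norm is finite. -/
theorem bddAbove_tsum (x : PosStrongSeq p X) :
    BddAbove (Set.range fun b : {b : PosWeakDualSeq p.conjExponent X // 0 ≤ b ∧ ‖b‖ ≤ 1} =>
      ∑' n, b.1 n |x n|) := by
  have hq : (0 : ℝ) < p.conjExponent := zero_lt_one.trans_le factConjExponent.out
  by_contra hcon
  have hex : ∀ k : ℕ, ∃ b : PosWeakDualSeq p.conjExponent X, (0 ≤ b ∧ ‖b‖ ≤ 1) ∧
      (4 : ℝ) ^ k < ∑' n, b n |x n| := by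
    intro k
    by_contra! h
    exact hcon ⟨4 ^ k, by rintro _ ⟨b, rfl⟩; exact h b.1 b.2⟩
  choose b hb hlt using hex
  have hbn : ∀ k n, 0 ≤ b k n := fun k n => PosWeakDualSeq.nonneg_apply (hb k).1 n
  have hnorm : ∀ k n, ‖b k n‖ ≤ 1 := fun k n => by
    refine ContinuousLinearMap.opNorm_le_bound _ zero_le_one fun y => ?_
    have h1 := PosWeakDualSeq.abs_apply_le_eval (b k) (abs_nonneg y) n
    have h2 := PosWeakDualSeq.eval_le_norm (b k) (abs_nonneg y)
    rw [abs_of_nonneg (hbn k n)] at h1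
    rw [norm_abs_eq_norm] at h2
    rw [Real.norm_eq_abs]
    calc |b k n y| ≤ b k n |y| := abs_apply_le (hbn k n) y
      _ ≤ ‖b k‖ * ‖y‖ := h1.trans h2
      _ ≤ 1 * ‖y‖ := mul_le_mul_of_nonneg_right (hb k).2 (norm_nonneg y)
  have hs : ∀ n, Summable fun k : ℕ => ((1 / 2 : ℝ) ^ k) • b k n := fun n => by
    refine Summable.of_norm_bounded summable_geometric_two fun k => ?_
    rw [norm_smul, Real.norm_of_nonneg (by positivity)]
    exact mul_le_of_le_one_right (by positivity) (hnorm k n)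
  let c : ℕ → StrongDual ℝ X := fun n => ∑' k, ((1 / 2 : ℝ) ^ k) • b k n
  have hcs : ∀ n y, HasSum (fun k : ℕ => (1 / 2 : ℝ) ^ k * b k n y) (c n y) := fun n y => by
    exact (hs n).hasSum.mapL (ContinuousLinearMap.apply ℝ ℝ y)
  have hc0 : ∀ n, 0 ≤ c n := fun n y hy => (hcs n y).nonneg fun k =>
    mul_nonneg (by positivity) (apply_nonneg (hbn k n) hy)
  have hle : ∀ k n y, 0 ≤ y → (1 / 2 : ℝ) ^ k * b k n y ≤ c n y := fun k n y hy =>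
    le_hasSum (hcs n y) k fun j _ => mul_nonneg (by positivity) (apply_nonneg (hbn j n) hy)
  have hmem : c ∈ posWeakDualSubmodule p.conjExponent X := fun y hy => by
    refine summable_of_sum_le (c := (2 * ‖y‖) ^ p.conjExponent)
      (fun n => Real.rpow_nonneg (abs_apply_nonneg _ hy) _) fun s => ?_
    have hlim : Filter.Tendsto (fun K : ℕ => ∑ n ∈ s,
        (∑ k ∈ Finset.range K, (1 / 2 : ℝ) ^ k * b k n y) ^ p.conjExponent) Filter.atTop
        (nhds (∑ n ∈ s, (|c n| y) ^ p.conjExponent)) := by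
      refine tendsto_finsetSum _ fun n _ => ?_
      rw [abs_of_nonneg (hc0 n)]
      exact (hcs n y).tendsto_sum_nat.rpow_const (Or.inr hq.le)
    refine le_of_tendsto' hlim fun K => ?_
    let d : PosWeakDualSeq p.conjExponent X := ∑ k ∈ Finset.range K, ((1 / 2 : ℝ) ^ k) • b k
    have hd : ∀ n y, d n y = ∑ k ∈ Finset.range K, (1 / 2 : ℝ) ^ k * b k n y := fun n y => by
      have h1 : d n = ∑ k ∈ Finset.range K, ((1 / 2 : ℝ) ^ k) • b k n := by
        have := map_sum ((LinearMap.proj n).comp (posWeakDualSubmodule p.conjExponent X).subtype)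
          (fun k => ((1 / 2 : ℝ) ^ k) • (b k : posWeakDualSubmodule p.conjExponent X))
          (Finset.range K)
        exact this
      rw [h1]
      simp
    have hdn : ‖d‖ ≤ 2 := by
      refine (norm_sum_le _ _).trans (le_trans (Finset.sum_le_sum fun k _ => ?_)
        (sum_geometric_two_le K))
      rw [norm_smul, Real.norm_of_nonneg (by positivity)]
      exact mul_le_of_le_one_right (by positivity) (hb k).2
    have hd0 : ∀ n, 0 ≤ d n := fun n z hz => by
      rw [hd n z]
      exact Finset.sum_nonneg fun k _ => mul_nonneg (by positivity) (apply_nonneg (hbn k n) hz)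
    have h2 : d.eval y ≤ 2 * ‖y‖ := (d.eval_le_norm hy).trans
      (mul_le_mul_of_nonneg_right hdn (norm_nonneg y))
    have h3 : ∑' n, (|d n| y) ^ p.conjExponent ≤ (2 * ‖y‖) ^ p.conjExponent := by
      have h4 := Real.rpow_le_rpow (d.eval_nonneg hy) h2 hq.le
      rwa [PosWeakDualSeq.eval, ← Real.rpow_mul (d.tsum_nonneg hy), one_div_mul_cancel hq.ne',
        Real.rpow_one] at h4
    refine le_trans ?_ h3
    refine le_trans (le_of_eq ?_) ((d.summable hy).sum_le_tsum s
      fun n _ => Real.rpow_nonneg (abs_apply_nonneg _ hy) _)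
    refine Finset.sum_congr rfl fun n _ => ?_
    rw [abs_of_nonneg (hd0 n), hd n y]
  let C : PosWeakDualSeq p.conjExponent X := ⟨c, hmem⟩
  have hC : 0 ≤ C := hc0
  have hbound : ∀ k : ℕ, (2 : ℝ) ^ k ≤ ∑' n, C n |x n| := fun k => by
    calc (2 : ℝ) ^ k = (1 / 2) ^ k * 4 ^ k := by rw [← mul_pow]; norm_num
      _ ≤ (1 / 2) ^ k * ∑' n, b k n |x n| :=
        mul_le_mul_of_nonneg_left (hlt k).le (by positivity)
      _ = ∑' n, (1 / 2) ^ k * b k n |x n| := tsum_mul_left.symm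
      _ ≤ ∑' n, C n |x n| := ((x.summable (hb k).1).mul_left _).tsum_le_tsum
        (fun n => hle k n _ (abs_nonneg _)) (x.summable hC)
  obtain ⟨k, hk⟩ := pow_unbounded_of_one_lt (∑' n, C n |x n|) one_lt_two
  exact absurd (hbound k) (not_le.2 hk)

theorem tsum_le_norm_of_le_one (x : PosStrongSeq p X) {b : PosWeakDualSeq p.conjExponent X}
    (hb : 0 ≤ b) (h1 : ‖b‖ ≤ 1) : ∑' n, b n |x n| ≤ ‖x‖ :=
  le_ciSup (bddAbove_tsum x) ⟨b, hb, h1⟩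

theorem norm_le_iff (x : PosStrongSeq p X) {c : ℝ} :
    ‖x‖ ≤ c ↔ ∀ b : PosWeakDualSeq p.conjExponent X, 0 ≤ b → ‖b‖ ≤ 1 → ∑' n, b n |x n| ≤ c := by
  have : Nonempty {b : PosWeakDualSeq p.conjExponent X // 0 ≤ b ∧ ‖b‖ ≤ 1} :=
    ⟨⟨0, le_rfl, by simp⟩⟩
  exact ⟨fun h b hb h1 => (tsum_le_norm_of_le_one x hb h1).trans h,
    fun h => ciSup_le fun b => h b.1 b.2.1 b.2.2⟩

theorem norm_nonneg' (x : PosStrongSeq p X) : 0 ≤ ‖x‖ := by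
  have := tsum_le_norm_of_le_one x (b := 0) le_rfl (by simp)
  simpa [PosWeakDualSeq.zero_apply] using this

theorem eq_zero_of_norm (x : PosStrongSeq p X) (hx : ‖x‖ = 0) : x = 0 := by
  have hq : p.conjExponent ≠ 0 := (zero_lt_one.trans_le factConjExponent.out).ne'
  refine ext fun n => ?_
  obtain ⟨f, -, hf⟩ := exists_dual_vector'' ℝ |x n|
  let c : ℕ → StrongDual ℝ X := Pi.single n |f|
  have hc0 : ∀ m, 0 ≤ c m := fun m => by
    rcases eq_or_ne m n with rfl | h
    · simp [c]
    · simp [c, h]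
  have hmem : c ∈ posWeakDualSubmodule p.conjExponent X := fun y hy => by
    refine summable_of_ne_finset_zero (s := {n}) fun m hm => ?_
    have hm' : m ≠ n := by simpa using hm
    simp [c, hm', Real.zero_rpow hq]
  let C : PosWeakDualSeq p.conjExponent X := ⟨c, hmem⟩
  have hC : 0 ≤ C := hc0
  let r : ℝ := (‖C‖ + 1)⁻¹
  have hr : 0 < r := by positivity
  have hrC : 0 ≤ r • C := fun m y hy => by
    change 0 ≤ r * c m y
    exact mul_nonneg hr.le (apply_nonneg (hc0 m) hy)
  have hn : ‖r • C‖ ≤ 1 := by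
    rw [norm_smul, Real.norm_of_nonneg hr.le, inv_mul_le_iff₀ (by positivity)]
    linarith
  have h1 := tsum_le_norm_of_le_one x hrC hn
  have h2 := ((x.summable hrC).le_tsum n fun j _ => x.term_nonneg hrC j).trans h1
  rw [hx] at h2
  have h3 : (r • C) n |x n| = r * |f| |x n| := by
    change r * c n |x n| = _
    simp [c]
  rw [h3] at h2
  have h4 : |f| |x n| ≤ 0 := nonpos_of_mul_nonpos_right h2 hr
  have h5 : f |x n| ≤ |f| |x n| := le_abs_self f _ (abs_nonneg _)
  have h6 : ‖x n‖ ≤ 0 := by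
    rw [← norm_abs_eq_norm (x n)]
    simpa using (hf.symm.le.trans h5).trans h4
  exact norm_le_zero_iff.1 h6

instance : NormedAddCommGroup (PosStrongSeq p X) :=
  AddGroupNorm.toNormedAddCommGroup
    { toFun := norm
      map_zero' := le_antisymm
        ((norm_le_iff _).2 fun b _ _ => by simp [zero_apply]) (norm_nonneg' _)
      add_le' := fun x y => (norm_le_iff _).2 fun b hb h1 => by
        refine le_trans ?_ (add_le_add (tsum_le_norm_of_le_one x hb h1)
          (tsum_le_norm_of_le_one y hb h1))
        rw [← (x.summable hb).tsum_add (y.summable hb)]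
        refine ((x + y).summable hb).tsum_le_tsum (fun n => ?_)
          ((x.summable hb).add (y.summable hb))
        rw [← map_add]
        exact apply_mono (PosWeakDualSeq.nonneg_apply hb n) (abs_add_le (x n) (y n))
      neg' := fun x => by simp only [norm_def, neg_apply, abs_neg]
      eq_zero_of_map_eq_zero' := eq_zero_of_norm }

instance : NormedSpace ℝ (PosStrongSeq p X) where
  norm_smul_le c x := (norm_le_iff _).2 fun b hb h1 => by
    refine le_trans ?_ (mul_le_mul_of_nonneg_left (tsum_le_norm_of_le_one x hb h1) (abs_nonneg c))
    rw [← tsum_mul_left]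
    refine ((c • x).summable hb).tsum_le_tsum (fun n => ?_) ((x.summable hb).mul_left _)
    rw [← smul_eq_mul, ← map_smul]
    exact apply_mono (PosWeakDualSeq.nonneg_apply hb n) (abs_smul_le_abs_smul_abs c (x n))

instance : HasSolidNorm (PosStrongSeq p X) where
  solid x y h := (norm_le_iff _).2 fun b hb h1 => by
    refine le_trans ?_ (tsum_le_norm_of_le_one y hb h1)
    refine (x.summable hb).tsum_le_tsum (fun n => ?_) (y.summable hb)
    exact apply_mono (PosWeakDualSeq.nonneg_apply hb n) (h n)

end PosStrongSeq

end Strong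

end

/-!
Write `q = p / (p - 1)`. A sequence `a` in `ℓ_{q,|ω|}(X*)` acts on `ℓ_p^π(X)` by
`x ↦ ∑ₙ aₙ(xₙ)` (`toDual`). Since `|aₙ(xₙ)| ≤ |aₙ|(|xₙ|)`, the definition of the norm of
`ℓ_p^π(X)` gives absolute convergence and `‖toDual a‖ ≤ ‖a‖`.

In the other direction, a functional `φ` is sent to its coordinates `φ ∘ eₙ` (`ofDual`). For
`x ≥ 0` choose `|yₙ| ≤ x` with `φ(eₙ yₙ)` close to `|φ ∘ eₙ|(x)` by the Riesz–Kantorovich formula.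
For weights `lₙ ≥ 0`, Hölder's inequality bounds the norm of the finite sequence `(lₙ yₙ)` by
`‖l‖_p ‖x‖` (`PosStrongSeq.norm_trunc_le`), so `∑ lₙ |φ ∘ eₙ|(x) ≤ ‖φ‖ ‖x‖ ‖l‖_p`. By the converse
of Hölder's inequality, `(φ ∘ eₙ)ₙ` lies in `ℓ_{q,|ω|}(X*)` with norm at most `‖φ‖`
(`sum_coord_rpow_le`).

Clearly `ofDual ∘ toDual` is the identity, and `toDual (ofDual φ)` agrees with `φ` on finite
sequences. These are dense in `ℓ_p^π(X)` (`PosStrongSeq.exists_norm_sub_trunc_le`), by a gliding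
hump argument: if all tails of `x` had norm larger than `ε`, there would be positive blocks with
disjoint supports in the unit ball of `ℓ_{q,|ω|}(X*)`, each pairing with `|x|` to more than `ε`; the
sum of `K` of them has norm at most `K ^ (1/q)` but pairs with `|x|` to at least `K ε`, which is
impossible for large `K` because `q > 1`.

So `toDual` is a bijection, and it is isometric because it and its inverse are both contractive. It
preserves and reflects the order, hence it preserves the lattice operations.
-/

noncomputable section

/-! ### The modulus of a functional -/

namespace DualLattice

variable {X : Type*} [NormedAddCommGroup X] [NormedSpace ℝ X] [Lattice X] [HasSolidNorm X]
  [IsOrderedAddMonoid X]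

/-- The Riesz–Kantorovich formula for the modulus, `|f| x = sup {f y : |y| ≤ x}`, in the form of
an approximation. -/
theorem exists_abs_le_abs_apply_lt (f : StrongDual ℝ X) {x : X} (hx : 0 ≤ x) {ε : ℝ}
    (hε : 0 < ε) : ∃ y : X, |y| ≤ x ∧ |f| x < f y + ε := by
  have h : |f| x = f x + posFun (-f - f) x := by
    rw [← pos_apply _ hx]
    rfl
  obtain ⟨_, ⟨z, hz, rfl⟩, hlt⟩ := exists_lt_of_lt_csSup
    (s := (-f - f) '' Set.Icc 0 x) ⟨_, 0, ⟨le_rfl, hx⟩, rfl⟩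
    (show posFun (-f - f) x - ε < sSup ((-f - f) '' Set.Icc 0 x) from sub_lt_self _ hε)
  -- `0 ≤ z ≤ x` makes `y = x - 2 z` range over `|y| ≤ x`, and `f x + (-f - f) z = f (x - 2 z)`
  refine ⟨x - z - z, abs_le'.2 ⟨?_, ?_⟩, ?_⟩
  · exact (sub_le_self _ hz.1).trans (sub_le_self _ hz.1)
  · rw [neg_sub, sub_sub_eq_add_sub, sub_le_iff_le_add]
    exact add_le_add hz.2 hz.2
  · simp only [_root_.sub_apply, _root_.neg_apply, map_sub] at hlt ⊢
    linarith

end DualLattice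

open DualLattice

variable {p : ℝ} [hp : Fact (1 < p)] {X : Type*} [NormedAddCommGroup X] [NormedSpace ℝ X]
  [Lattice X] [HasSolidNorm X] [IsOrderedAddMonoid X] [IsOrderedModule ℝ X]

/-! ### Finite sequences and norm bounds in `ℓ_{q,|ω|}(X*)` -/

namespace PosWeakDualSeq

/-- The sequence `d` restricted to the finite set `s` and extended by zero. -/
def ofFinset (s : Finset ℕ) (d : ℕ → StrongDual ℝ X) : PosWeakDualSeq p.conjExponent X :=
  ⟨fun n => if n ∈ s then d n else 0, fun y _ => by
    have hq : p.conjExponent ≠ 0 := (zero_lt_one.trans_le factConjExponent.out).ne'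
    refine summable_of_ne_finset_zero (s := s) fun n hn => ?_
    simp [hn, Real.zero_rpow hq]⟩

theorem ofFinset_apply (s : Finset ℕ) (d : ℕ → StrongDual ℝ X) (n : ℕ) :
    (ofFinset s d : PosWeakDualSeq p.conjExponent X) n = if n ∈ s then d n else 0 := rfl

theorem ofFinset_nonneg {s : Finset ℕ} {d : ℕ → StrongDual ℝ X} (hd : ∀ n, 0 ≤ d n) :
    (0 : PosWeakDualSeq p.conjExponent X) ≤ ofFinset s d := fun n => by
  change 0 ≤ if n ∈ s then d n else 0
  split_ifs
  exacts [hd n, le_rfl]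

variable [CompleteSpace X]

theorem norm_abs (a : PosWeakDualSeq p.conjExponent X) : ‖|a|‖ = ‖a‖ := norm_abs_eq_norm a

theorem zero_le_abs (a : PosWeakDualSeq p.conjExponent X) : 0 ≤ |a| := abs_nonneg a

theorem abs_apply (a : PosWeakDualSeq p.conjExponent X) (n : ℕ) : |a| n = |a n| := rfl

/-- A bound for the norm of a sequence by its finite partial sums. -/
theorem norm_le_of_sum_le (a : PosWeakDualSeq p.conjExponent X) {C : ℝ} (hC : 0 ≤ C)
    (h : ∀ x : X, 0 ≤ x → ∀ s : Finset ℕ,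
      ∑ n ∈ s, (|a n| x) ^ p.conjExponent ≤ (C * ‖x‖) ^ p.conjExponent) : ‖a‖ ≤ C := by
  have hq : (0 : ℝ) < p.conjExponent := zero_lt_one.trans_le factConjExponent.out
  refine (norm_le_iff a).2 fun x hx h1 => ?_
  have h2 := (a.summable hx).tsum_le_of_sum_le (h x hx)
  calc a.eval x ≤ ((C * ‖x‖) ^ p.conjExponent) ^ (1 / p.conjExponent) :=
        Real.rpow_le_rpow (a.tsum_nonneg hx) h2 (by positivity)
    _ = C * ‖x‖ := by
        rw [← Real.rpow_mul (by positivity), mul_one_div_cancel hq.ne', Real.rpow_one]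
    _ ≤ C := mul_le_of_le_one_right hC h1

/-- The partial sums of `(|aₙ|(x) ^ q)` in terms of the norm. -/
theorem sum_rpow_le (a : PosWeakDualSeq p.conjExponent X) {x : X} (hx : 0 ≤ x) (s : Finset ℕ) :
    ∑ n ∈ s, (|a n| x) ^ p.conjExponent ≤ (‖a‖ * ‖x‖) ^ p.conjExponent := by
  have hq : (0 : ℝ) < p.conjExponent := zero_lt_one.trans_le factConjExponent.out
  have h := Real.rpow_le_rpow (a.eval_nonneg hx) (a.eval_le_norm hx) hq.le
  rw [eval, ← Real.rpow_mul (a.tsum_nonneg hx), one_div_mul_cancel hq.ne', Real.rpow_one] at h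
  exact ((a.summable hx).sum_le_tsum s
    fun n _ => Real.rpow_nonneg (abs_apply_nonneg _ hx) _).trans h

end PosWeakDualSeq

/-! ### Finite sequences in `ℓ_p^π(X)` -/

namespace PosStrongSeq

theorem mem_of_finite_support {x : ℕ → X} (s : Finset ℕ) (h : ∀ n ∉ s, x n = 0) :
    x ∈ posStrongSubmodule p X := fun b _ =>
  summable_of_ne_finset_zero (s := s) fun n hn => by simp [h n hn]

/-- The sequence `x` restricted to the finite set `s` and extended by zero. -/
def trunc (s : Finset ℕ) (x : ℕ → X) : PosStrongSeq p X :=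
  ⟨fun n => if n ∈ s then x n else 0, mem_of_finite_support s fun n hn => by simp [hn]⟩

theorem trunc_apply (s : Finset ℕ) (x : ℕ → X) (n : ℕ) :
    (trunc s x : PosStrongSeq p X) n = if n ∈ s then x n else 0 := rfl

variable [CompleteSpace X]

theorem tsum_le_norm_mul_norm (x : PosStrongSeq p X) {b : PosWeakDualSeq p.conjExponent X}
    (hb : 0 ≤ b) : ∑' n, b n |x n| ≤ ‖b‖ * ‖x‖ := by
  rcases eq_or_ne b 0 with rfl | h0
  · simp [PosWeakDualSeq.zero_apply]
  have hpos : 0 < ‖b‖ := norm_pos_iff.2 h0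
  have hc : 0 ≤ ‖b‖⁻¹ • b := fun n y hy =>
    mul_nonneg (inv_nonneg.2 hpos.le) (apply_nonneg (PosWeakDualSeq.nonneg_apply hb n) hy)
  have h1 := tsum_le_norm_of_le_one x hc
    (by rw [norm_smul, norm_inv, norm_norm, inv_mul_cancel₀ hpos.ne'])
  have h2 : ∑' n, (‖b‖⁻¹ • b) n |x n| = ‖b‖⁻¹ * ∑' n, b n |x n| := tsum_mul_left
  rwa [h2, inv_mul_le_iff₀ hpos] at h1

/-- By Hölder's inequality, a sequence dominated by `(lₙ x)` has norm at most `‖l‖_p ‖x‖`. -/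
theorem norm_trunc_le {x : X} (hx : 0 ≤ x) {l : ℕ → ℝ} (hl : ∀ n, 0 ≤ l n) {y : ℕ → X}
    (hy : ∀ n, |y n| ≤ l n • x) (s : Finset ℕ) :
    ‖(trunc s y : PosStrongSeq p X)‖ ≤ (∑ n ∈ s, l n ^ p) ^ (1 / p) * ‖x‖ := by
  refine (norm_le_iff _).2 fun b hb h1 => ?_
  have hq : (0 : ℝ) < p.conjExponent := zero_lt_one.trans_le factConjExponent.out
  have hbn := PosWeakDualSeq.nonneg_apply hb
  have hsum : 0 ≤ ∑ n ∈ s, l n ^ p := Finset.sum_nonneg fun n _ => Real.rpow_nonneg (hl n) p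
  have hbx : (∑ n ∈ s, (b n x) ^ p.conjExponent) ^ (1 / p.conjExponent) ≤ ‖x‖ := by
    have h := b.sum_rpow_le hx s
    simp only [fun n => abs_of_nonneg (hbn n)] at h
    calc _ ≤ ((‖b‖ * ‖x‖) ^ p.conjExponent) ^ (1 / p.conjExponent) :=
          Real.rpow_le_rpow (Finset.sum_nonneg fun n _ =>
            Real.rpow_nonneg (apply_nonneg (hbn n) hx) _) h (by positivity)
      _ = ‖b‖ * ‖x‖ := by
          rw [← Real.rpow_mul (by positivity), mul_one_div_cancel hq.ne', Real.rpow_one]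
      _ ≤ ‖x‖ := mul_le_of_le_one_left (norm_nonneg x) h1
  calc ∑' n, b n |(trunc s y : PosStrongSeq p X) n| = ∑ n ∈ s, b n |y n| := by
        rw [tsum_eq_sum (s := s) fun n hn => by simp [trunc_apply, hn]]
        exact Finset.sum_congr rfl fun n hn => by simp [trunc_apply, hn]
    _ ≤ ∑ n ∈ s, l n * b n x := Finset.sum_le_sum fun n _ => by
        have := apply_mono (hbn n) (hy n)
        rwa [map_smul, smul_eq_mul] at this
    _ ≤ (∑ n ∈ s, l n ^ p) ^ (1 / p) *
          (∑ n ∈ s, (b n x) ^ p.conjExponent) ^ (1 / p.conjExponent) :=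
        Real.inner_le_Lp_mul_Lq_of_nonneg s (Real.HolderConjugate.conjExponent hp.out)
          (fun n _ => hl n) fun n _ => apply_nonneg (hbn n) hx
    _ ≤ _ := mul_le_mul_of_nonneg_left hbx (Real.rpow_nonneg hsum _)

theorem norm_trunc_singleton_le (n : ℕ) (x : X) :
    ‖(trunc {n} fun _ => x : PosStrongSeq p X)‖ ≤ ‖x‖ := by
  have h := norm_trunc_le (p := p) (abs_nonneg x) (l := fun _ => 1) (fun _ => zero_le_one)
    (y := fun _ => x) (fun _ => by rw [one_smul]) {n}
  rw [norm_abs_eq_norm] at h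
  simpa using h

/-- The embedding of `X` as the `n`-th coordinate. -/
def single (n : ℕ) : X →L[ℝ] PosStrongSeq p X :=
  LinearMap.mkContinuous
    { toFun := fun x => trunc {n} fun _ => x
      map_add' := fun x y => ext fun m => by
        simp only [trunc_apply, add_apply]
        split_ifs <;> simp
      map_smul' := fun c x => ext fun m => by
        simp only [trunc_apply, smul_apply, RingHom.id_apply]
        split_ifs <;> simp } 1
    fun x => by simpa using norm_trunc_singleton_le n x

theorem single_apply (n : ℕ) (x : X) (m : ℕ) :
    (single n x : PosStrongSeq p X) m = if m = n then x else 0 := by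
  change (if m ∈ ({n} : Finset ℕ) then x else 0) = _
  simp

theorem trunc_eq_sum (s : Finset ℕ) (x : ℕ → X) :
    (trunc s x : PosStrongSeq p X) = ∑ n ∈ s, single n (x n) := by
  refine ext fun m => ?_
  have h := map_sum ((LinearMap.proj m).comp (posStrongSubmodule p X).subtype)
    (fun n => (single n (x n) : posStrongSubmodule p X)) s
  refine Eq.trans ?_ h.symm
  change (if m ∈ s then x m else 0) = ∑ n ∈ s, (single n (x n) : PosStrongSeq p X) m
  simp [single_apply]

/-! ### Density of the finite sequences -/

/-- The step of the gliding hump: if the tail of `x` after the index `M` has norm larger than `ε`,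
then some positive block beyond `M`, of norm at most one, pairs with `|x|` to more than `ε`. -/
theorem exists_block (x : PosStrongSeq p X) {ε : ℝ} {M : ℕ}
    (h : ε < ‖x - trunc (Finset.range M) x‖) :
    ∃ b : PosWeakDualSeq p.conjExponent X, 0 ≤ b ∧ ‖b‖ ≤ 1 ∧
      ∃ M', M ≤ M' ∧ ε < ∑ n ∈ Finset.Ico M M', b n |x n| := by
  have h1 := mt (norm_le_iff (x - trunc (Finset.range M) x)).2 (not_le.2 h)
  push Not at h1
  obtain ⟨b, hb, hb1, hlt⟩ := h1
  have hlim := ((x - trunc (Finset.range M) x).summable hb).hasSum.tendsto_sum_nat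
  obtain ⟨M', hM', hMM'⟩ :=
    ((hlim.eventually_const_lt hlt).and (Filter.eventually_ge_atTop M)).exists
  refine ⟨b, hb, hb1, M', hMM', hM'.trans_le (le_of_eq ?_)⟩
  have hterm : ∀ n, (x - trunc (Finset.range M) x : PosStrongSeq p X) n
      = if n < M then 0 else x n := fun n => by
    change x n - (if n ∈ Finset.range M then x n else 0) = _
    simp only [Finset.mem_range]
    split_ifs <;> simp
  rw [← Finset.sum_range_add_sum_Ico _ hMM', Finset.sum_eq_zero, zero_add]
  · exact Finset.sum_congr rfl fun n hn => by
      rw [hterm, if_neg (not_lt.2 (Finset.mem_Ico.1 hn).1)]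
  · intro n hn
    simp [hterm, Finset.mem_range.1 hn]

/-- The gliding hump: if no tail of `x` has norm at most `ε`, then `K` disjoint blocks can be put
together to a positive finite sequence that pairs with `|x|` to at least `K ε`, while the `q`-th
power of its norm is at most `K`. -/
theorem exists_blocks (x : PosStrongSeq p X) {ε : ℝ}
    (h : ∀ M, ε < ‖x - trunc (Finset.range M) x‖) (K : ℕ) :
    ∃ (M : ℕ) (d : ℕ → StrongDual ℝ X), (∀ n, 0 ≤ d n) ∧
      (∀ y, 0 ≤ y → ∑ n ∈ Finset.range M, (d n y) ^ p.conjExponent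
        ≤ K * ‖y‖ ^ p.conjExponent) ∧
      K * ε ≤ ∑ n ∈ Finset.range M, d n |x n| := by
  have hq : (0 : ℝ) < p.conjExponent := zero_lt_one.trans_le factConjExponent.out
  induction K with
  | zero => exact ⟨0, 0, fun _ => le_rfl, by simp, by simp⟩
  | succ K ih =>
    obtain ⟨M, d, hd, hdle, hdx⟩ := ih
    obtain ⟨b, hb, hb1, M', hMM', hbx⟩ := exists_block x (h M)
    have hbn := PosWeakDualSeq.nonneg_apply hb
    have hsplit : ∀ F : StrongDual ℝ X → ℕ → ℝ,
        ∑ n ∈ Finset.range M', F (if n < M then d n else b n) n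
          = ∑ n ∈ Finset.range M, F (d n) n + ∑ n ∈ Finset.Ico M M', F (b n) n := fun F => by
      rw [← Finset.sum_range_add_sum_Ico _ hMM']
      congr 1
      · exact Finset.sum_congr rfl fun n hn => by rw [if_pos (Finset.mem_range.1 hn)]
      · exact Finset.sum_congr rfl fun n hn => by
          rw [if_neg (not_lt.2 (Finset.mem_Ico.1 hn).1)]
    refine ⟨M', fun n => if n < M then d n else b n, fun n => ?_, fun y hy => ?_, ?_⟩
    · dsimp only
      split_ifs
      exacts [hd n, hbn n]
    · have h1 := b.sum_rpow_le hy (Finset.Ico M M')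
      simp only [fun n => abs_of_nonneg (hbn n)] at h1
      have h2 : (‖b‖ * ‖y‖) ^ p.conjExponent ≤ ‖y‖ ^ p.conjExponent :=
        Real.rpow_le_rpow (by positivity) (mul_le_of_le_one_left (norm_nonneg y) hb1) hq.le
      rw [hsplit fun f _ => (f y) ^ p.conjExponent]
      push_cast
      linarith [hdle y hy]
    · rw [hsplit fun f n => f |x n|]
      push_cast
      linarith

/-- Finitely supported sequences are dense: the truncations of `x` approximate it in norm. With
`q > 1`, the blocks of `exists_blocks` would otherwise force `K ε ≤ K ^ (1/q) ‖x‖` for all `K`. -/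
theorem exists_norm_sub_trunc_le (x : PosStrongSeq p X) {ε : ℝ} (hε : 0 < ε) :
    ∃ M, ‖x - trunc (Finset.range M) x‖ ≤ ε := by
  by_contra! h
  have hpq := Real.HolderConjugate.conjExponent hp.out
  have hq : (0 : ℝ) < p.conjExponent := hpq.symm.pos
  have hK : ∀ K : ℕ, K * ε ≤ (K : ℝ) ^ (1 / p.conjExponent) * ‖x‖ := fun K => by
    obtain ⟨M, d, hd, hdle, hdx⟩ := exists_blocks x h K
    let D : PosWeakDualSeq p.conjExponent X := PosWeakDualSeq.ofFinset (Finset.range M) d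
    have hD : 0 ≤ D := PosWeakDualSeq.ofFinset_nonneg hd
    have hDn : ‖D‖ ≤ (K : ℝ) ^ (1 / p.conjExponent) := by
      refine D.norm_le_of_sum_le (by positivity) fun y hy s => ?_
      rw [Real.mul_rpow (by positivity) (norm_nonneg y), ← Real.rpow_mul (by positivity),
        one_div_mul_cancel hq.ne', Real.rpow_one]
      refine le_trans ?_ (hdle y hy)
      calc ∑ n ∈ s, (|D n| y) ^ p.conjExponent
          = ∑ n ∈ s, if n ∈ Finset.range M then (d n y) ^ p.conjExponent else 0 :=
            Finset.sum_congr rfl fun n _ => by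
              rw [abs_of_nonneg (PosWeakDualSeq.nonneg_apply hD n),
                PosWeakDualSeq.ofFinset_apply]
              split_ifs
              · rfl
              · simp [Real.zero_rpow hq.ne']
        _ = ∑ n ∈ s ∩ Finset.range M, (d n y) ^ p.conjExponent := by
            rw [Finset.sum_ite_mem]
        _ ≤ _ := Finset.sum_le_sum_of_subset_of_nonneg Finset.inter_subset_right
            fun n _ _ => Real.rpow_nonneg (apply_nonneg (hd n) hy) _
    calc K * ε ≤ ∑ n ∈ Finset.range M, d n |x n| := hdx
      _ = ∑' n, D n |x n| := by
          rw [tsum_eq_sum (s := Finset.range M) fun n hn => by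
            rw [PosWeakDualSeq.ofFinset_apply, if_neg hn]; rfl]
          exact Finset.sum_congr rfl fun n hn => by
            rw [PosWeakDualSeq.ofFinset_apply, if_pos hn]
      _ ≤ ‖D‖ * ‖x‖ := tsum_le_norm_mul_norm x hD
      _ ≤ _ := mul_le_mul_of_nonneg_right hDn (norm_nonneg x)
  have hlim : Filter.Tendsto (fun K : ℕ => (K : ℝ) ^ (1 / p)) Filter.atTop Filter.atTop :=
    (tendsto_rpow_atTop (one_div_pos.2 hpq.pos)).comp tendsto_natCast_atTop_atTop
  obtain ⟨K, hK1, hK2⟩ :=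
    ((hlim.eventually_gt_atTop (‖x‖ / ε)).and (Filter.eventually_gt_atTop 0)).exists
  have hK0 : (0 : ℝ) < K := Nat.cast_pos.2 hK2
  have hr : 0 < (K : ℝ) ^ (1 / p.conjExponent) := Real.rpow_pos_of_pos hK0 _
  have hprod : (K : ℝ) = (K : ℝ) ^ (1 / p.conjExponent) * (K : ℝ) ^ (1 / p) := by
    rw [← Real.rpow_add hK0, one_div, one_div, hpq.symm.inv_add_inv_eq_one, Real.rpow_one]
  have h1 := hK K
  nth_rw 1 [hprod] at h1
  rw [mul_assoc, mul_le_mul_iff_right₀ hr] at h1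
  rw [div_lt_iff₀ hε] at hK1
  linarith

end PosStrongSeq

/-! ### The pairing of `ℓ_{q,|ω|}(X*)` with `ℓ_p^π(X)` -/

namespace PosWeakDualSeq

variable [CompleteSpace X]

theorem summable_abs_pairing (a : PosWeakDualSeq p.conjExponent X) (x : PosStrongSeq p X) :
    Summable fun n => |a n| |x n| := by
  simpa only [abs_apply] using x.summable (zero_le_abs a)

theorem abs_pairing_le (a : PosWeakDualSeq p.conjExponent X) (x : PosStrongSeq p X) (n : ℕ) :
    |a n (x n)| ≤ |a n| |x n| := by
  have hle : ∀ y : X, 0 ≤ y → |a n y| ≤ |a n| y := fun y hy =>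
    abs_le'.2 ⟨le_abs_self (a n) y hy, neg_le_abs (a n) y hy⟩
  calc |a n (x n)| = |a n (x n)⁺ - a n (x n)⁻| := by
        rw [← map_sub, posPart_sub_negPart]
    _ ≤ |a n (x n)⁺| + |a n (x n)⁻| := abs_sub _ _
    _ ≤ |a n| (x n)⁺ + |a n| (x n)⁻ :=
        add_le_add (hle _ (posPart_nonneg _)) (hle _ (negPart_nonneg _))
    _ = |a n| |x n| := by rw [← map_add, posPart_add_negPart]

theorem summable_pairing (a : PosWeakDualSeq p.conjExponent X) (x : PosStrongSeq p X) :
    Summable fun n => a n (x n) :=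
  Summable.of_norm_bounded (summable_abs_pairing a x) (abs_pairing_le a x)

/-- The functional `x ↦ ∑ₙ aₙ(xₙ)` on `ℓ_p^π(X)`. -/
def toDual (a : PosWeakDualSeq p.conjExponent X) : StrongDual ℝ (PosStrongSeq p X) :=
  LinearMap.mkContinuous
    { toFun := fun x => ∑' n, a n (x n)
      map_add' := fun x y => by
        rw [← (summable_pairing a x).tsum_add (summable_pairing a y)]
        exact tsum_congr fun n => map_add (a n) (x n) (y n)
      map_smul' := fun c x => by
        rw [RingHom.id_apply, smul_eq_mul, ← tsum_mul_left]
        exact tsum_congr fun n => map_smul (a n) c (x n) } ‖a‖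
    fun x => by
      refine (tsum_of_norm_bounded (summable_abs_pairing a x).hasSum
        (abs_pairing_le a x)).trans ?_
      exact (x.tsum_le_norm_mul_norm (zero_le_abs a)).trans_eq (by rw [norm_abs])

theorem hasSum_toDual (a : PosWeakDualSeq p.conjExponent X) (x : PosStrongSeq p X) :
    HasSum (fun n => a n (x n)) (toDual a x) := (summable_pairing a x).hasSum

theorem norm_toDual_le (a : PosWeakDualSeq p.conjExponent X) : ‖toDual a‖ ≤ ‖a‖ :=
  LinearMap.mkContinuous_norm_le _ (norm_nonneg a) _

theorem toDual_single (a : PosWeakDualSeq p.conjExponent X) (n : ℕ) (x : X) :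
    toDual a (PosStrongSeq.single n x) = a n x := by
  refine (hasSum_toDual a _).unique ?_
  have h := hasSum_single (f := fun m => a m ((PosStrongSeq.single n x : PosStrongSeq p X) m)) n
    fun m hm => by simp [PosStrongSeq.single_apply, hm]
  simpa [PosStrongSeq.single_apply] using h

/-! ### The coordinates of a functional -/

/-- The coordinates `φ ∘ eₙ` of a functional on `ℓ_p^π(X)`, tested against weights `l`. -/
theorem sum_mul_coord_le (φ : StrongDual ℝ (PosStrongSeq p X)) {x : X} (hx : 0 ≤ x)
    {l : ℕ → ℝ} (hl : ∀ n, 0 ≤ l n) (s : Finset ℕ) :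
    ∑ n ∈ s, l n * |φ.comp (PosStrongSeq.single n)| x
      ≤ ‖φ‖ * ‖x‖ * (∑ n ∈ s, l n ^ p) ^ (1 / p) := by
  refine le_of_forall_pos_le_add fun ε hε => ?_
  have hL : 0 ≤ ∑ n ∈ s, l n := Finset.sum_nonneg fun n _ => hl n
  have hδ : 0 < ε / (∑ n ∈ s, l n + 1) := by positivity
  choose y hy hlt using fun n =>
    exists_abs_le_abs_apply_lt (φ.comp (PosStrongSeq.single n)) hx hδ
  have hz := PosStrongSeq.norm_trunc_le (p := p) hx hl (y := fun n => l n • y n) (fun n =>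
    (abs_smul_le_abs_smul_abs (l n) (y n)).trans (by
      rw [abs_of_nonneg (hl n)]
      exact smul_le_smul_of_nonneg_left (hy n) (hl n))) s
  calc ∑ n ∈ s, l n * |φ.comp (PosStrongSeq.single n)| x
      ≤ ∑ n ∈ s, (φ (PosStrongSeq.single n (l n • y n))
          + l n * (ε / (∑ n ∈ s, l n + 1))) := Finset.sum_le_sum fun n _ => by
        have := mul_le_mul_of_nonneg_left (hlt n).le (hl n)
        rw [mul_add] at this
        simpa using this
    _ = φ (PosStrongSeq.trunc s fun n => l n • y n)
          + (∑ n ∈ s, l n) * (ε / (∑ n ∈ s, l n + 1)) := by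
        rw [Finset.sum_add_distrib, PosStrongSeq.trunc_eq_sum, map_sum, Finset.sum_mul]
    _ ≤ ‖φ‖ * ‖x‖ * (∑ n ∈ s, l n ^ p) ^ (1 / p) + ε := by
        refine add_le_add ?_ ?_
        · refine (le_abs_self _).trans ((φ.le_opNorm _).trans ?_)
          rw [mul_assoc, mul_comm ‖x‖]
          exact mul_le_mul_of_nonneg_left hz (norm_nonneg φ)
        · rw [mul_div_assoc', div_le_iff₀ (by positivity)]
          nlinarith

/-- The converse of Hölder's inequality, applied to `sum_mul_coord_le` with the extremal weights
`lₙ = |φ ∘ eₙ|(x) ^ (q - 1)`. -/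
theorem sum_coord_rpow_le (φ : StrongDual ℝ (PosStrongSeq p X)) {x : X} (hx : 0 ≤ x)
    (s : Finset ℕ) :
    ∑ n ∈ s, (|φ.comp (PosStrongSeq.single n)| x) ^ p.conjExponent
      ≤ (‖φ‖ * ‖x‖) ^ p.conjExponent := by
  have hpq := Real.HolderConjugate.conjExponent hp.out
  have hq : (0 : ℝ) < p.conjExponent := hpq.symm.pos
  have hq1 : 0 < p.conjExponent - 1 := hpq.symm.sub_one_pos
  set u : ℕ → ℝ := fun n => |φ.comp (PosStrongSeq.single n)| x
  have hu : ∀ n, 0 ≤ u n := fun n => abs_apply_nonneg _ hx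
  have h := sum_mul_coord_le φ hx (l := fun n => u n ^ (p.conjExponent - 1))
    (fun n => Real.rpow_nonneg (hu n) _) s
  have h1 : ∀ n, u n ^ (p.conjExponent - 1) * u n = u n ^ p.conjExponent := fun n => by
    rw [← Real.rpow_add_one' (hu n) (by simpa using hq.ne'), sub_add_cancel]
  have h2 : ∀ n, (u n ^ (p.conjExponent - 1)) ^ p = u n ^ p.conjExponent := fun n => by
    rw [← Real.rpow_mul (hu n), hpq.symm.sub_one_mul_conj]
  change ∑ n ∈ s, u n ^ (p.conjExponent - 1) * u n ≤ _ at h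
  simp only [h1, h2] at h
  set S := ∑ n ∈ s, u n ^ p.conjExponent
  have hS : 0 ≤ S := Finset.sum_nonneg fun n _ => Real.rpow_nonneg (hu n) _
  rcases hS.eq_or_lt with h0 | hpos
  · rw [← h0]
    positivity
  have hr : 0 < S ^ (1 / p) := Real.rpow_pos_of_pos hpos _
  have hprod : S = S ^ (1 / p.conjExponent) * S ^ (1 / p) := by
    rw [← Real.rpow_add hpos, one_div, one_div, hpq.symm.inv_add_inv_eq_one, Real.rpow_one]
  have h3 : S ^ (1 / p.conjExponent) ≤ ‖φ‖ * ‖x‖ := by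
    refine le_of_mul_le_mul_right ?_ hr
    rwa [← hprod]
  have h4 := Real.rpow_le_rpow (Real.rpow_nonneg hS _) h3 hq.le
  rwa [← Real.rpow_mul hS, one_div_mul_cancel hq.ne', Real.rpow_one] at h4

/-- The sequence of coordinates `φ ∘ eₙ` of a functional on `ℓ_p^π(X)`. -/
def ofDual (φ : StrongDual ℝ (PosStrongSeq p X)) : PosWeakDualSeq p.conjExponent X :=
  ⟨fun n => φ.comp (PosStrongSeq.single n), fun _ hx =>
    summable_of_sum_le (fun _ => Real.rpow_nonneg (abs_apply_nonneg _ hx) _)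
      (sum_coord_rpow_le φ hx)⟩

theorem ofDual_apply (φ : StrongDual ℝ (PosStrongSeq p X)) (n : ℕ) (x : X) :
    ofDual φ n x = φ (PosStrongSeq.single n x) := rfl

theorem norm_ofDual_le (φ : StrongDual ℝ (PosStrongSeq p X)) : ‖ofDual φ‖ ≤ ‖φ‖ :=
  norm_le_of_sum_le _ (norm_nonneg φ) fun _ hx s => sum_coord_rpow_le φ hx s

theorem ofDual_toDual (a : PosWeakDualSeq p.conjExponent X) : ofDual (toDual a) = a :=
  ext fun n => ContinuousLinearMap.ext fun x => toDual_single a n x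

/-! ### The isometry and the order -/

theorem toDual_ofDual (φ : StrongDual ℝ (PosStrongSeq p X)) : toDual (ofDual φ) = φ := by
  rw [← sub_eq_zero]
  set ψ := toDual (ofDual φ) - φ
  have hψ : ∀ (s : Finset ℕ) (x : ℕ → X), ψ (PosStrongSeq.trunc s x) = 0 := fun s x => by
    rw [PosStrongSeq.trunc_eq_sum, map_sum]
    refine Finset.sum_eq_zero fun n _ => ?_
    change toDual (ofDual φ) _ - φ _ = 0
    rw [toDual_single, ofDual_apply, sub_self]
  ext x
  refine norm_le_zero_iff.1 (le_of_forall_pos_le_add fun ε hε => ?_)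
  obtain ⟨M, hM⟩ := x.exists_norm_sub_trunc_le (ε := ε / (‖ψ‖ + 1)) (by positivity)
  calc ‖ψ x‖ = ‖ψ (x - PosStrongSeq.trunc (Finset.range M) x)‖ := by
        rw [map_sub, hψ, sub_zero]
    _ ≤ ‖ψ‖ * (ε / (‖ψ‖ + 1)) :=
        (ψ.le_opNorm _).trans (mul_le_mul_of_nonneg_left hM (norm_nonneg ψ))
    _ ≤ 0 + ε := by
        rw [mul_div_assoc', div_le_iff₀ (by positivity)]
        nlinarith [norm_nonneg ψ]

variable (p X) in
/-- The isometry `a ↦ (x ↦ ∑ₙ aₙ(xₙ))` of `ℓ_{p*,|ω|}(X*)` onto the dual of `ℓ_p^π(X)`. -/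
def dualIsometry : PosWeakDualSeq p.conjExponent X ≃ₗᵢ[ℝ] StrongDual ℝ (PosStrongSeq p X) where
  toFun := toDual
  invFun := ofDual
  left_inv := ofDual_toDual
  right_inv := toDual_ofDual
  map_add' a b := ContinuousLinearMap.ext fun x =>
    (hasSum_toDual (a + b) x).unique ((hasSum_toDual a x).add (hasSum_toDual b x))
  map_smul' c a := ContinuousLinearMap.ext fun x =>
    (hasSum_toDual (c • a) x).unique ((hasSum_toDual a x).mul_left c)
  norm_map' a := le_antisymm (norm_toDual_le a) <| by
    have h := norm_ofDual_le (toDual a)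
    rwa [ofDual_toDual] at h

theorem toDual_le_toDual_iff {a b : PosWeakDualSeq p.conjExponent X} :
    toDual a ≤ toDual b ↔ a ≤ b := by
  refine ⟨fun h n x hx => ?_, fun h x hx => ?_⟩
  · rw [← toDual_single a, ← toDual_single b]
    refine h _ fun m => ?_
    change 0 ≤ (PosStrongSeq.single n x : PosStrongSeq p X) m
    rw [PosStrongSeq.single_apply]
    split_ifs
    exacts [hx, le_rfl]
  · exact hasSum_le (fun n => h n (x n) (hx n)) (hasSum_toDual a x) (hasSum_toDual b x)

variable (p X) in
/-- The map `toDual` as an order isomorphism. -/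
def dualOrderIso : PosWeakDualSeq p.conjExponent X ≃o StrongDual ℝ (PosStrongSeq p X) where
  toEquiv := (dualIsometry p X).toEquiv
  map_rel_iff' := toDual_le_toDual_iff

end PosWeakDualSeq

end

theorem mainTheorem1 {X : Type*} [NormedAddCommGroup X] [NormedSpace ℝ X] [CompleteSpace X]
    [Lattice X] [HasSolidNorm X] [IsOrderedAddMonoid X] [IsOrderedModule ℝ X]
    (p : ℝ) [Fact (1 < p)] :
    ∃ T : PosWeakDualSeq p.conjExponent X ≃ₗᵢ[ℝ] StrongDual ℝ (PosStrongSeq p X),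
      (∀ a b, T (a ⊔ b) = T a ⊔ T b) ∧
      (∀ a b, T (a ⊓ b) = T a ⊓ T b) ∧
      ∀ a x, HasSum (fun n => a n (x n)) (T a x) :=
  ⟨PosWeakDualSeq.dualIsometry p X,
    fun a b => (PosWeakDualSeq.dualOrderIso p X).map_sup a b,
    fun a b => (PosWeakDualSeq.dualOrderIso p X).map_inf a b,
    PosWeakDualSeq.hasSum_toDual⟩
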